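/- **Parameters.** Let $\mathbf N$ be the set of tuples $\mathbf n=(T,\mathrm{nor},\bar\lambda,\bar\mu)$ such that: - $T\subseteq\omega^{<\omega}$ is a non-empty set closed under initial segments; $\bar\lambda=(\lambda_\eta:\eta\in T)$ are pairwise distinct non-zero natural numbers with $\eta^\frown m\in T\iff m<\lambda_\eta$ for all $\eta\in T$, $m\in\omega$; $\bar\mu=(\mu_\eta:\eta\in T)$ are non-negative reals. Write $\mathrm{suc}_S(\eta)$ for the set of immediate successors of $\eta$ in a tree $S$. - If $\mathrm{lg}(\eta)=\mathrm{lg}(\nu)$ and $\eta<_{lex}\nu$, or if $\mathrm{lg}(\eta)<\mathrm{lg}(\nu)$, then $\lambda_\eta<\lambda_\nu$; and $\mathrm{lg}(\eta)<\mu_\eta<\lambda_\eta$ for all $\eta\in T$. - For $\eta\in T$, $\mathrm{nor}_\eta$ assigns to each non-empty $a\subseteq\mathrm{suc}_T(\eta)$ a real $\mathrm{nor}_\eta(a)\ge 0$, monotonically with respect to inclusion, and $(\mathrm{lg}(\eta)+1)^2\le\mu_\eta\le\mathrm{nor}_\eta(\mathrm{suc}_T(\eta))$. - $\prod\{\lambda_\nu:\nu\in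 T,\ \lambda_\nu<\lambda_\eta\}<\mu_\eta$. - (Co-bigness) If $k>0$ is real, $1\le j\le\mu_\eta$, and $a_0,\dots,a_{j-1}\subseteq\mathrm{suc}_T(\eta)$ are non-empty with $\mathrm{nor}_\eta(a_i)\ge k+\frac1{\mu_\eta}$ for all $i<j$, then $\bigcap_{i<j}a_i\neq\emptyset$ and $\mathrm{nor}_\eta(\bigcap_{i<j}a_i)\ge k$. - If $\mathrm{nor}_\eta(a)\ge 1$ then $|a|>\frac12|\mathrm{suc}_T(\eta)|$. - If $k>0$, $\mathrm{nor}_\eta(a)\ge k+\frac1{\mu_\eta}$, $\rho\in a$ and $a\setminus\{\rho\}\ne\emptyset$, then $\mathrm{nor}_\eta(a\setminus\{\rho\})\ge k$. **The forcing.** For $\mathbf n\in\mathbf N$, a condition $p\in\mathbb Q^1_{\mathbf n}$ is a subtree $T_p\subseteq T$ (closed under initial segments, without maximal nodes) with a trunk $\mathrm{tr}(p)\in T_p$, such that every node of $T_p$ is comparable with $\mathrm{tr}(p)$; along every infinite branch $x$ of $T_p$ the norms $\mathrm{nor}_{x\restriction l}(\mathrm{suc}_{T_p}(x\restriction l))$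 tend to $\infty$; $\mathrm{nor}_\eta(\mathrm{suc}_{T_p}(\eta))\ge 2-\frac1{\mu_{\mathrm{tr}(p)}}$ for all $\eta\in T_p$ extending $\mathrm{tr}(p)$; and for every $N<\omega$ there is $k>\mathrm{lg}(\mathrm{tr}(p))$ such that $\mathrm{nor}_\eta(\mathrm{suc}_{T_p}(\eta))\ge N$ for all $\eta\in T_p$ with $\mathrm{lg}(\eta)\ge k$. A condition $q$ is stronger than $p$ iff $T_q\subseteq T_p$. Hechler forcing $\mathbb D$ consists of the pairs $(s,f)$ with $s\in\omega^{<\omega}$ an initial segment of $f\in\omega^\omega$; $(t,g)$ is stronger than $(s,f)$ iff $s$ is an initial segment of $t$ and $f(i)\le g(i)$ for all $i$. A real $x\in\omega^\omega$ is a Hechler real over the ground model $V$ if the set of all $(s,f)\in\mathbb D^V$ such that $s$ is an initial segment of $x$ and $f(i)\le x(i)$ for all $i$ is a $V$-generic filter on $\mathbb D^V$. **Claim.** For every $\mathbf n\in\mathbf N$: (a) $\mathbb Q^1_{\mathbf n}$ adds a dominating real: there is a $\mathbb Q^1_{\mathbf n}$-name $\tau$ of a member of $\omega^\omega$ such that for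 every $h\in\omega^\omega$ of the ground model, $\Vdash$ "$h(i)\le\tau(i)$ for all but finitely many $i$". (b) $\mathbb Q^1_{\mathbf n}$ adds a Hechler real: there is a $\mathbb Q^1_{\mathbf n}$-name $\rho$ of a member of $\omega^\omega$ such that $\Vdash$ "$\rho$ is a Hechler real over the ground model". -/

import Mathlib

/-! ### Forcing notions and names of reals

Forcing notions are preorders in which larger conditions are stronger. -/

namespace Forcing

/-- A (nice) `P`-name of a member of `ω^ω`: the name `{((i,m)ˇ, c) : c ∈ rel i m}` of a set of
pairs, which is forced by every condition to be a total function from `ω` to `ω`. -/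
structure RealName (P : Type*) [Preorder P] where
  rel : ℕ → ℕ → Set P
  total : ∀ (i : ℕ) (p : P), ∃ q, p ≤ q ∧ ∃ m, ∃ c ∈ rel i m, c ≤ q
  functional : ∀ (i m m' : ℕ) (c c' r : P), c ∈ rel i m → c' ∈ rel i m' →
    c ≤ r → c' ≤ r → m = m'

namespace RealName

variable {P : Type*} [Preorder P]

/-- `p ⊩ τ(i) = m`. -/
def ForcesEq (τ : RealName P) (p : P) (i m : ℕ) : Prop :=
  ∀ q, p ≤ q → ∃ r, q ≤ r ∧ ∃ c ∈ τ.rel i m, c ≤ r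

/-- `p ⊩ τ(i) ≥ k`, that is, `p ⊩ ∃ m ≥ k, τ(i) = m`. -/
def ForcesGe (τ : RealName P) (p : P) (i k : ℕ) : Prop :=
  ∀ q, p ≤ q → ∃ r, q ≤ r ∧ ∃ m, k ≤ m ∧ τ.ForcesEq r i m

/-- `p ⊩ ∃ j, ∀ i ≥ j, h(i) ≤ τ(i)`, for a real `h` of the ground model. -/
def ForcesDominates (τ : RealName P) (p : P) (h : ℕ → ℕ) : Prop :=
  ∀ q, p ≤ q → ∃ r, q ≤ r ∧ ∃ j : ℕ, ∀ i, j ≤ i → τ.ForcesGe r i (h i)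

/-- Every condition forces that `τ` is a dominating real over the ground model. -/
def IsDominating (τ : RealName P) : Prop :=
  ∀ (p : P) (h : ℕ → ℕ), τ.ForcesDominates p h

end RealName

/-- Hechler forcing: pairs `(stem, fn)` with `stem ∈ ω^{<ω}` an initial segment of
`fn ∈ ω^ω`. -/
structure Hechler where
  stem : List ℕ
  fn : ℕ → ℕ
  stem_eq : ∀ (i : ℕ) (hi : i < stem.length), fn i = stem[i]

instance : Preorder Hechler where
  le d e := d.stem <+: e.stem ∧ ∀ i, d.fn i ≤ e.fn i
  le_refl d := ⟨List.prefix_refl _, fun _ => le_refl _⟩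
  le_trans _ _ _ h₁ h₂ := ⟨h₁.1.trans h₂.1, fun i => (h₁.2 i).trans (h₂.2 i)⟩

namespace RealName

variable {P : Type*} [Preorder P]

/-- `p ⊩ d ∈ G_τ`, where `G_x`, for a real `x`, is the set of all `(s, f)` in Hechler forcing
such that `s` is an initial segment of `x` and `f(i) ≤ x(i)` for all `i`. -/
def ForcesMem (τ : RealName P) (p : P) (d : Hechler) : Prop :=
  (∀ (i : ℕ) (hi : i < d.stem.length), τ.ForcesEq p i d.stem[i]) ∧
    ∀ i, τ.ForcesGe p i (d.fn i)

/-- Every condition forces that `τ` is a Hechler real over the ground model: `G_τ` is a filter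
on Hechler forcing (of the ground model) that meets every dense set of the ground model. -/
structure IsHechler (τ : RealName P) : Prop where
  downward : ∀ (p : P) (d e : Hechler), d ≤ e → τ.ForcesMem p e → τ.ForcesMem p d
  directed : ∀ (p : P) (d e : Hechler), τ.ForcesMem p d → τ.ForcesMem p e →
    ∀ q, p ≤ q → ∃ r, q ≤ r ∧ ∃ g, d ≤ g ∧ e ≤ g ∧ τ.ForcesMem r g
  generic : ∀ D : Set Hechler, (∀ d, ∃ e ∈ D, d ≤ e) →
    ∀ p : P, ∀ q, p ≤ q → ∃ r, q ≤ r ∧ ∃ d ∈ D, τ.ForcesMem r d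

end RealName

end Forcing

/-! ### The parameters and the tree-creature forcing -/

namespace TreeCreature

/-- The immediate successors of `η` in `S`; the successor `η⌢m` is identified with `m`. -/
def suc (S : Set (List ℕ)) (η : List ℕ) : Set ℕ := {m | η ++ [m] ∈ S}

/-- The initial segment of length `l` of `x ∈ ω^ω`. -/
def res (x : ℕ → ℕ) (l : ℕ) : List ℕ := (List.range l).map x

open Classical in
/-- The product of all the numbers `lam ν` (`ν ∈ T`) that are smaller than `lam η`. -/
noncomputable def lamBelow (T : Set (List ℕ)) (lam : List ℕ → ℕ) (η : List ℕ) : ℕ :=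
  ∏ k ∈ (Finset.range (lam η)).filter (fun k => ∃ ν ∈ T, lam ν = k), k

/-- The parameters. Only the values of `lam` and `mu` at nodes of `T`, and of `nor η` at
non-empty subsets of `suc T η` for `η ∈ T`, are relevant. The relation `≪` is read as `<`, its
weakest sense. -/
structure Param where
  T : Set (List ℕ)
  lam : List ℕ → ℕ
  mu : List ℕ → ℝ
  nor : List ℕ → Set ℕ → ℝ
  root_mem : [] ∈ T
  prefix_mem : ∀ η ∈ T, ∀ ν, ν <+: η → ν ∈ T
  mu_nonneg : ∀ η ∈ T, 0 ≤ mu η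
  lam_ne_zero : ∀ η ∈ T, lam η ≠ 0
  lam_injOn : Set.InjOn lam T
  suc_eq : ∀ η ∈ T, suc T η = Set.Iio (lam η)
  lam_lex : ∀ η ∈ T, ∀ ν ∈ T, η.length = ν.length → List.Lex (· < ·) η ν → lam η < lam ν
  length_lt_lam : ∀ η ∈ T, η.length < lam η
  lam_lt_lam : ∀ η ∈ T, ∀ ν ∈ T, η.length < ν.length → lam η < lam ν
  length_lt_mu : ∀ η ∈ T, (η.length : ℝ) < mu η
  mu_lt_lam : ∀ η ∈ T, mu η < lam η
  nor_nonneg : ∀ η ∈ T, ∀ a ⊆ suc T η, a.Nonempty → 0 ≤ nor η a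
  nor_mono : ∀ η ∈ T, ∀ a b : Set ℕ, a.Nonempty → a ⊆ b → b ⊆ suc T η → nor η a ≤ nor η b
  sq_le_mu : ∀ η ∈ T, ((η.length : ℝ) + 1) ^ 2 ≤ mu η
  mu_le_nor : ∀ η ∈ T, mu η ≤ nor η (suc T η)
  lamBelow_lt_mu : ∀ η ∈ T, (lamBelow T lam η : ℝ) < mu η
  /-- co-bigness -/
  coBig : ∀ η ∈ T, ∀ k : ℝ, 0 < k → ∀ (j : ℕ) (a : Fin j → Set ℕ), 0 < j → (j : ℝ) ≤ mu η →
    (∀ i, (a i).Nonempty ∧ a i ⊆ suc T η ∧ k + 1 / mu η ≤ nor η (a i)) →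
    (⋂ i, a i).Nonempty ∧ k ≤ nor η (⋂ i, a i)
  half_lt : ∀ η ∈ T, ∀ a ⊆ suc T η, a.Nonempty → 1 ≤ nor η a →
    (1 / 2 : ℝ) < (a.ncard : ℝ) / ((suc T η).ncard : ℝ)
  nor_diff : ∀ η ∈ T, ∀ k : ℝ, 0 < k → ∀ a ⊆ suc T η, ∀ m ∈ a, (a \ {m}).Nonempty →
    k + 1 / mu η ≤ nor η a → k ≤ nor η (a \ {m})

/-- `S` is (the tree of) a condition of `ℚ⁰_n` with trunk `s`. -/
structure IsQ0 (n : Param) (s : List ℕ) (S : Set (List ℕ)) : Prop where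
  trunk_mem : s ∈ S
  subset_T : ∀ η ∈ S, η ∈ n.T ∧ (η <+: s ∨ s <+: η)
  prefix_mem : ∀ η ∈ S, ∀ ν, ν <+: η → ν ∈ S
  no_max : ∀ η ∈ S, ∃ m, η ++ [m] ∈ S
  nor_tendsto : ∀ x : ℕ → ℕ, (∀ l, res x l ∈ S) →
    Filter.Tendsto (fun l => n.nor (res x l) (suc S (res x l))) Filter.atTop Filter.atTop
  /-- the infimum of the norms at the nodes above the trunk is at least `2 - 1/μ_s` -/
  le_nor : ∀ η ∈ S, s <+: η → 2 - 1 / n.mu s ≤ n.nor η (suc S η)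

/-- The forcing notion `ℚ¹_n`. -/
structure Q1 (n : Param) where
  trunk : List ℕ
  tree : Set (List ℕ)
  isQ0 : IsQ0 n trunk tree
  uniform : ∀ N : ℕ, ∃ k : ℕ, trunk.length < k ∧
    ∀ η ∈ tree, k ≤ η.length → (N : ℝ) ≤ n.nor η (suc tree η)

instance (n : Param) : Preorder (Q1 n) where
  le p q := q.tree ⊆ p.tree
  le_refl p := Set.Subset.refl p.tree
  le_trans _ _ _ h₁ h₂ := Set.Subset.trans h₂ h₁

end TreeCreature

/-! ### Forced values and Hechler filters -/

namespace Forcing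

namespace RealName

variable {P : Type*} [Preorder P] {τ : RealName P} {p q : P} {i m m' k k' : ℕ}

/-! A Hechler real is dominating, so one name serves both claims. Rank a successor `m` by the norm
of the initial segment ending in `m`, in steps of 5. Deleting a point costs at most 1, and two large
sets meet in a large set. Hence a set of large norm contains every small enough rank
(`exists_rank_eq`), while discarding ranks `≥ w` keeps norms up to about `5 * w`
(`nor_inter_rank_lt`). Ranks code finite sets of indices, and the name sends `i` to the first level
where `i` is coded.

For genericity, pass to a node coding exactly the indices below some `M`; their values form a
Hechler stem. Beyond it, demand values so large that the norms at those levels allow any required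
code. Given an extension `e` in the dense set, realize the stem of `e` by choosing ranks
(`exists_extension`). Then bound the ranks by a slow `W → ∞`, so that no other `i` appears before
level `e.fn i` (`exists_prune`, `exists_slow_bound`). Since `W` is unbounded, the result is still a
condition. -/

lemma ForcesEq.mono (h : τ.ForcesEq p i m) (hpq : p ≤ q) : τ.ForcesEq q i m :=
  fun r hr => h r (hpq.trans hr)

lemma ForcesGe.mono (h : τ.ForcesGe p i k) (hpq : p ≤ q) : τ.ForcesGe q i k :=
  fun r hr => h r (hpq.trans hr)

lemma ForcesGe.of_le (h : τ.ForcesGe p i k) (hk : k' ≤ k) : τ.ForcesGe p i k' := by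
  intro q hq
  obtain ⟨r, hr, m, hm, hf⟩ := h q hq
  exact ⟨r, hr, m, hk.trans hm, hf⟩

lemma ForcesEq.forcesGe (h : τ.ForcesEq p i m) : τ.ForcesGe p i m :=
  fun q hq => ⟨q, le_rfl, m, le_rfl, h.mono hq⟩

lemma ForcesEq.unique (h : τ.ForcesEq p i m) (h' : τ.ForcesEq p i m') : m = m' := by
  obtain ⟨r, hr, c, hc, hcr⟩ := h p le_rfl
  obtain ⟨r', hr', c', hc', hcr'⟩ := h' r hr
  exact τ.functional i m m' c c' r' hc hc' (hcr.trans hr') hcr'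

lemma ForcesGe.le_of_forcesEq (h : τ.ForcesGe p i k) (h' : τ.ForcesEq p i m) : k ≤ m := by
  obtain ⟨r, hr, m', hm', hf⟩ := h p le_rfl
  exact hm'.trans_eq (hf.unique (h'.mono hr))

lemma forcesEq_of_mem_rel (h : p ∈ τ.rel i m) : τ.ForcesEq p i m :=
  fun q hq => ⟨q, le_rfl, p, h, hq⟩

lemma ForcesMem.mono {d : Hechler} (h : τ.ForcesMem p d) (hpq : p ≤ q) : τ.ForcesMem q d :=
  ⟨fun i hi => (h.1 i hi).mono hpq, fun i => (h.2 i).mono hpq⟩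

lemma ForcesMem.of_le {d e : Hechler} (hde : d ≤ e) (h : τ.ForcesMem p e) : τ.ForcesMem p d := by
  refine ⟨fun i hi => ?_, fun i => (h.2 i).of_le (hde.2 i)⟩
  have := h.1 i (hi.trans_le hde.1.length_le)
  rwa [← hde.1.getElem hi] at this

/-- Two Hechler conditions that are forced into `G_τ`, the second one having the longer stem, have
a common extension that is forced into `G_τ`. -/
lemma ForcesMem.exists_upper_bound {d e : Hechler} (hd : τ.ForcesMem p d) (he : τ.ForcesMem p e)
    (hde : d.stem.length ≤ e.stem.length) : ∃ g, d ≤ g ∧ e ≤ g ∧ τ.ForcesMem p g := by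
  -- On the longer stem the function must be `e.fn`. It dominates `d.fn` there because `p` decides
  -- those values.
  refine ⟨⟨e.stem, fun i => if i < e.stem.length then e.fn i else max (d.fn i) (e.fn i),
    fun i hi => by simp [hi, e.stem_eq i hi]⟩, ⟨?_, fun i => ?_⟩, ⟨List.prefix_refl _, fun i => ?_⟩,
    he.1, fun i => ?_⟩
  · rw [List.prefix_iff_getElem]
    exact ⟨hde, fun i hi => (hd.1 i hi).unique (he.1 i (hi.trans_le hde))⟩
  · dsimp only
    split_ifs with hi
    · rw [e.stem_eq i hi]
      exact (hd.2 i).le_of_forcesEq (he.1 i hi)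
    · exact le_max_left _ _
  · dsimp only
    split_ifs with hi
    · exact le_rfl
    · exact le_max_right _ _
  · dsimp only
    split_ifs with hi
    · exact he.2 i
    · rcases le_total (d.fn i) (e.fn i) with h | h
      · rw [max_eq_right h]
        exact he.2 i
      · rw [max_eq_left h]
        exact hd.2 i

lemma ForcesMem.directed {d e : Hechler} (hd : τ.ForcesMem p d) (he : τ.ForcesMem p e) :
    ∃ g, d ≤ g ∧ e ≤ g ∧ τ.ForcesMem p g := by
  rcases le_total d.stem.length e.stem.length with h | h
  · exact hd.exists_upper_bound he h
  · obtain ⟨g, h₁, h₂, h₃⟩ := he.exists_upper_bound hd h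
    exact ⟨g, h₂, h₁, h₃⟩

/-- Only genericity needs to be checked for a Hechler real. -/
lemma IsHechler.of_generic
    (h : ∀ D : Set Hechler, (∀ d, ∃ e ∈ D, d ≤ e) →
      ∀ p : P, ∃ r, p ≤ r ∧ ∃ d ∈ D, τ.ForcesMem r d) : τ.IsHechler where
  downward _ _ _ hde he := he.of_le hde
  directed _ _ _ hd he q hq := ⟨q, le_rfl, (hd.mono hq).directed (he.mono hq)⟩
  generic D hD _ q _ := h D hD q

/-- A Hechler real is dominating. -/
lemma IsHechler.isDominating (hτ : τ.IsHechler) : τ.IsDominating := by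
  intro p h q hq
  -- Raising the function above `h` beyond the stem shows that this set is dense.
  obtain ⟨r, hr, d, ⟨j, hj⟩, hd⟩ := hτ.generic {d | ∃ j, ∀ i, j ≤ i → h i ≤ d.fn i} (fun d =>
    ⟨⟨d.stem, fun i => if i < d.stem.length then d.fn i else max (d.fn i) (h i),
      fun i hi => by simp [hi, d.stem_eq i hi]⟩,
      ⟨d.stem.length, fun i hi => by simp [not_lt.2 hi]⟩, List.prefix_refl _, fun i => by
        dsimp only
        split_ifs
        · exact le_rfl
        · exact le_max_left _ _⟩) p q hq
  exact ⟨r, hr, j, fun i hi => (hd.2 i).of_le (hj i hi)⟩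

end RealName

end Forcing

namespace TreeCreature

open Set

/-! ### Norms of initial segments and ranks of successors -/

namespace Param

variable {n : Param} {η : List ℕ}

lemma one_lt_mu (hη : η ∈ n.T) : 1 < n.mu η := by
  classical
  have h := n.lamBelow_lt_mu η hη
  have : 1 ≤ lamBelow n.T n.lam η := by
    refine Nat.one_le_iff_ne_zero.2 (Finset.prod_ne_zero_iff.2 fun k hk => ?_)
    obtain ⟨ν, hν, rfl⟩ := (Finset.mem_filter.1 hk).2
    exact n.lam_ne_zero ν hν
  exact lt_of_le_of_lt (by exact_mod_cast this) h

lemma two_le_mu (hη : η ∈ n.T) (h : 1 ≤ η.length) : 2 ≤ n.mu η := by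
  have h₁ := n.sq_le_mu η hη
  have h₂ : (1 : ℝ) ≤ η.length := by exact_mod_cast h
  nlinarith

lemma one_div_mu_le (hη : η ∈ n.T) : 1 / n.mu η ≤ 1 := by
  have := one_lt_mu hη
  rw [div_le_one (by linarith)]
  exact this.le

lemma one_lt_lam (hη : η ∈ n.T) : 1 < n.lam η := by
  have := (one_lt_mu hη).trans (n.mu_lt_lam η hη)
  exact_mod_cast this

lemma nor_singleton_lt (hη : η ∈ n.T) {m : ℕ} (hm : m ∈ suc n.T η) : n.nor η {m} < 1 := by
  by_contra! h
  have h₁ := n.half_lt η hη {m} (by simpa using hm) (singleton_nonempty m) h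
  rw [n.suc_eq η hη, ncard_singleton, ncard_eq_toFinset_card', toFinset_Iio, Nat.card_Iio] at h₁
  have h₂ : (2 : ℝ) ≤ n.lam η := by exact_mod_cast one_lt_lam hη
  rw [lt_div_iff₀ (by linarith)] at h₁
  push_cast at h₁
  linarith

/-- Co-bigness for two sets; away from the root `2 ≤ μ_η`, so `j = 2` is allowed. The loss `1 / μ_η`
is rounded up to 1. -/
lemma nor_inter (hη : η ∈ n.T) (hl : 1 ≤ η.length) {a b : Set ℕ} {k : ℝ} (hk : 0 < k)
    (ha : a.Nonempty) (hb : b.Nonempty) (haT : a ⊆ suc n.T η) (hbT : b ⊆ suc n.T η)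
    (hka : k + 1 ≤ n.nor η a) (hkb : k + 1 ≤ n.nor η b) :
    (a ∩ b).Nonempty ∧ k ≤ n.nor η (a ∩ b) := by
  have hμ := one_div_mu_le hη
  have h := n.coBig η hη k hk 2 ![a, b] two_pos (by exact_mod_cast two_le_mu hη hl) (by
    intro i
    fin_cases i
    · exact ⟨ha, haT, le_trans (by linarith) hka⟩
    · exact ⟨hb, hbT, le_trans (by linarith) hkb⟩)
  have e : ⋂ i, (![a, b] : Fin 2 → Set ℕ) i = a ∩ b := by
    ext x
    simp [Fin.forall_fin_two]
  rwa [e] at h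

/-- The successors `m` of `η` such that the initial segment of `suc_T(η)` ending in `m` has norm
smaller than `c`. -/
def cut (n : Param) (η : List ℕ) (c : ℝ) : Set ℕ := {m | m ∈ suc n.T η ∧ n.nor η (Iic m) < c}

lemma cut_subset (c : ℝ) : cut n η c ⊆ suc n.T η := fun _ h => h.1

lemma Iic_subset (hη : η ∈ n.T) {m : ℕ} (hm : m ∈ suc n.T η) : Iic m ⊆ suc n.T η := by
  rw [n.suc_eq η hη] at hm ⊢
  exact fun x (hx : x ≤ m) => hx.trans_lt (mem_Iio.1 hm)

lemma zero_mem_suc (hη : η ∈ n.T) : 0 ∈ suc n.T η := by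
  rw [n.suc_eq η hη]
  exact zero_lt_one.trans (one_lt_lam hη)

lemma zero_mem_cut (hη : η ∈ n.T) {c : ℝ} (hc : 1 ≤ c) : 0 ∈ cut n η c := by
  refine ⟨zero_mem_suc hη, ?_⟩
  have : Iic 0 = ({0} : Set ℕ) := by ext; simp
  rw [this]
  exact (nor_singleton_lt hη (zero_mem_suc hη)).trans_le hc

/-- The cut lies in the initial segment ending at its own maximum, which has norm below `c` by
definition. -/
lemma nor_cut_lt (hη : η ∈ n.T) {c : ℝ} (hc : 1 ≤ c) : n.nor η (cut n η c) < c := by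
  have hfin : (cut n η c).Finite := by
    refine (Set.finite_Iio (n.lam η)).subset ?_
    rw [← n.suc_eq η hη]
    exact cut_subset c
  obtain ⟨m, hm, hmax⟩ := exists_max_image (cut n η c) id hfin ⟨0, zero_mem_cut hη hc⟩
  exact (n.nor_mono η hη _ (Iic m) ⟨0, zero_mem_cut hη hc⟩ hmax
    (Iic_subset hη hm.1)).trans_lt hm.2

/-- The cut contains the first initial segment of norm at least `c` minus its last point, and
removing one point costs at most 1. If no segment reaches `c`, the cut is everything. -/
lemma le_nor_cut (hη : η ∈ n.T) {c : ℝ} (hc : 2 ≤ c) {k : ℝ} (hkc : k + 1 ≤ c)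
    (hk : k ≤ n.nor η (suc n.T η)) (hk₀ : 0 < k) : k ≤ n.nor η (cut n η c) := by
  classical
  by_cases h : ∃ m, m ∈ suc n.T η ∧ c ≤ n.nor η (Iic m)
  · obtain ⟨hs, hn⟩ := Nat.find_spec h
    have hmin : ∀ m < Nat.find h, m ∈ cut n η c := fun m hm => by
      have hmT : m ∈ suc n.T η := Iic_subset hη hs hm.le
      exact ⟨hmT, not_le.1 fun hle => Nat.find_min h hm ⟨hmT, hle⟩⟩
    have h0 : 0 < Nat.find h := by
      by_contra! h0
      have := (zero_mem_cut hη (by linarith : 1 ≤ c)).2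
      rw [Nat.le_zero.1 h0] at hn
      linarith
    have hne : (Iic (Nat.find h) \ {Nat.find h}).Nonempty := ⟨0, h0.le, h0.ne⟩
    have hμ := one_div_mu_le hη
    refine (n.nor_diff η hη k hk₀ _ (Iic_subset hη hs) _ self_mem_Iic hne (by linarith)).trans
      (n.nor_mono η hη _ _ hne ?_ (cut_subset c))
    exact fun m hm => hmin m (lt_of_le_of_ne hm.1 hm.2)
  · push Not at h
    have : cut n η c = suc n.T η := Subset.antisymm (cut_subset c) fun m hm => ⟨hm, h m hm⟩
    rwa [this]

/-- The rank of the successor `m` of `η`. -/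
noncomputable def rank (n : Param) (η : List ℕ) (m : ℕ) : ℕ := ⌊n.nor η (Iic m) / 5⌋₊

lemma rank_lt_iff {m w : ℕ} (hη : η ∈ n.T) (hm : m ∈ suc n.T η) :
    n.rank η m < w ↔ n.nor η (Iic m) < 5 * w := by
  have h0 := n.nor_nonneg η hη (Iic m) (Iic_subset hη hm) nonempty_Iic
  rw [rank, Nat.floor_lt (by positivity), div_lt_iff₀ (by norm_num), mul_comm]

/-- The part of `b` of rank at most `w` has norm at least `5 * w + 3`, but the successors of rank
below `w` together have norm below `5 * w`. The spacing 5 absorbs the losses from cutting and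
intersecting. -/
lemma exists_rank_eq (hη : η ∈ n.T) (hl : 1 ≤ η.length) {b : Set ℕ} (hb : b.Nonempty)
    (hbT : b ⊆ suc n.T η) {w : ℕ} (hw : 5 * ((w : ℝ) + 2) ≤ n.nor η b) :
    ∃ m ∈ b, n.rank η m = w := by
  have hw0 : (0 : ℝ) ≤ w := w.cast_nonneg
  have hc := le_nor_cut (n := n) hη (c := 5 * ((w + 1 : ℕ) : ℝ)) (by push_cast; linarith)
    (k := 5 * w + 4) (by push_cast; linarith)
    (le_trans (by linarith) (n.nor_mono η hη b _ hb hbT le_rfl)) (by linarith)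
  obtain ⟨⟨x, hx⟩, hn⟩ := nor_inter hη hl (k := 5 * w + 3) (by linarith) hb
    (b := cut n η (5 * ((w + 1 : ℕ) : ℝ))) ⟨0, zero_mem_cut hη (by push_cast; linarith)⟩ hbT
    (cut_subset _) (by linarith) (by linarith)
  by_contra! hne
  have hlt : ∀ m ∈ b ∩ cut n η (5 * ((w + 1 : ℕ) : ℝ)), n.rank η m < w := fun m hm =>
    lt_of_le_of_ne (Nat.lt_succ_iff.1 ((rank_lt_iff hη (hbT hm.1)).2 hm.2.2)) (hne m hm.1)
  -- A rank below `w` exists, so `w = 0` is excluded and `nor_cut_lt` applies.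
  have hw1 : (1 : ℝ) ≤ w := by exact_mod_cast (Nat.zero_le _).trans_lt (hlt x hx)
  have h₁ := n.nor_mono η hη _ (cut n η (5 * (w : ℝ))) ⟨x, hx⟩
    (fun m hm => ⟨hbT hm.1, (rank_lt_iff hη (hbT hm.1)).1 (hlt m hm)⟩) (cut_subset _)
  have h₂ := nor_cut_lt (n := n) hη (c := 5 * (w : ℝ)) (by linarith)
  linarith

/-- Restricting to the successors of small rank preserves largeness. -/
lemma nor_inter_rank_lt (hη : η ∈ n.T) (hl : 1 ≤ η.length) {b : Set ℕ} (hb : b.Nonempty)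
    (hbT : b ⊆ suc n.T η) {w : ℕ} (hw : 1 ≤ w) {k : ℝ} (hk : 0 < k) (hkb : k + 1 ≤ n.nor η b)
    (hkw : k + 2 ≤ 5 * w) :
    (b ∩ {m | n.rank η m < w}).Nonempty ∧ k ≤ n.nor η (b ∩ {m | n.rank η m < w}) := by
  have hw1 : (1 : ℝ) ≤ w := by exact_mod_cast hw
  have e : b ∩ {m | n.rank η m < w} = b ∩ cut n η (5 * (w : ℝ)) := by
    ext m
    exact ⟨fun h => ⟨h.1, hbT h.1, (rank_lt_iff hη (hbT h.1)).1 h.2⟩,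
      fun h => ⟨h.1, (rank_lt_iff hη (hbT h.1)).2 h.2.2⟩⟩
  rw [e]
  exact nor_inter hη hl hk hb ⟨0, zero_mem_cut hη (by linarith)⟩ hbT (cut_subset _) hkb
    (le_nor_cut hη (by linarith) (by linarith)
      (hkb.trans (n.nor_mono η hη b _ hb hbT le_rfl)) (by linarith))

/-! ### Active indices along a node -/

/-- The finite set of indices that are active at the successor `m` of `η`. -/
noncomputable def active (n : Param) (η : List ℕ) (m : ℕ) : Finset ℕ :=
  (Denumerable.eqv (Finset ℕ)).symm (n.rank η m)

/-- The index `i` is active at level `l` along `η`. -/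
def ActiveAt (n : Param) (η : List ℕ) (i l : ℕ) : Prop :=
  ∃ ν m, ν.length = l ∧ ν ++ [m] <+: η ∧ i ∈ n.active ν m

/-- The index `i` is active for the first time at level `l` along `η`. -/
def FirstAt (n : Param) (η : List ℕ) (i l : ℕ) : Prop :=
  n.ActiveAt η i l ∧ ∀ l' < l, ¬ n.ActiveAt η i l'

lemma ActiveAt.lt_length {i l : ℕ} (h : n.ActiveAt η i l) : l < η.length := by
  obtain ⟨ν, m, rfl, hp, -⟩ := h
  simpa using hp.length_le

lemma ActiveAt.of_comparable {ν : List ℕ} {i l : ℕ} (h : n.ActiveAt η i l)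
    (hc : η <+: ν ∨ ν <+: η) (hl : l < ν.length) : n.ActiveAt ν i l := by
  obtain ⟨σ, m, rfl, hp, hi⟩ := h
  refine ⟨σ, m, rfl, ?_, hi⟩
  rcases hc with hc | hc
  · exact hp.trans hc
  · exact List.prefix_of_prefix_length_le hp hc (by simpa using hl)

lemma FirstAt.of_comparable {ν : List ℕ} {i l : ℕ} (h : n.FirstAt η i l)
    (hc : η <+: ν ∨ ν <+: η) (hl : l < ν.length) : n.FirstAt ν i l :=
  ⟨h.1.of_comparable hc hl, fun l' hl' h' =>
    h.2 l' hl' (h'.of_comparable hc.symm (hl'.trans h.1.lt_length))⟩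

lemma FirstAt.unique {i l l' : ℕ} (h : n.FirstAt η i l) (h' : n.FirstAt η i l') : l = l' := by
  rcases lt_trichotomy l l' with hl | hl | hl
  · exact absurd h.1 (h'.2 l hl)
  · exact hl
  · exact absurd h'.1 (h.2 l' hl)

lemma ActiveAt.exists_firstAt {i l : ℕ} (h : n.ActiveAt η i l) : ∃ l', n.FirstAt η i l' := by
  classical
  have h' : ∃ l, n.ActiveAt η i l := ⟨l, h⟩
  exact ⟨Nat.find h', Nat.find_spec h', fun _ hl => Nat.find_min h' hl⟩

lemma not_activeAt_nil {i l : ℕ} : ¬ n.ActiveAt [] i l := fun h => by simpa using h.lt_length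

lemma activeAt_append_singleton {m i l : ℕ} : n.ActiveAt (η ++ [m]) i l ↔
    n.ActiveAt η i l ∨ l = η.length ∧ i ∈ n.active η m := by
  constructor
  · rintro ⟨ν, m', rfl, hp, hi⟩
    rcases List.prefix_concat_iff.1 hp with h | h
    · obtain ⟨rfl, h'⟩ := List.append_inj' h rfl
      obtain rfl : m' = m := by simpa using h'
      exact Or.inr ⟨rfl, hi⟩
    · exact Or.inl ⟨ν, m', rfl, h, hi⟩
  · rintro (h | ⟨rfl, hi⟩)
    · exact h.of_comparable (Or.inl (List.prefix_append _ _)) (by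
        have := h.lt_length
        rw [List.length_append]
        omega)
    · exact ⟨η, m, rfl, List.prefix_refl _, hi⟩

lemma exists_bound_active (n : Param) (η : List ℕ) : ∃ M, ∀ i l, n.ActiveAt η i l → i < M := by
  induction η using List.reverseRecOn with
  | nil => exact ⟨0, fun i l h => absurd h not_activeAt_nil⟩
  | append_singleton η m ih =>
    obtain ⟨M, hM⟩ := ih
    refine ⟨M + ((n.active η m).sup id + 1), fun i l h => ?_⟩
    rcases activeAt_append_singleton.1 h with h | ⟨-, h⟩
    · have := hM i l h
      omega
    · have := Finset.le_sup (f := id) h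
      simp only [id] at this
      omega

end Param

/-! ### Extending nodes and pruning conditions -/

namespace Q1

open Filter

variable {n : Param} {p q : Q1 n} {s : List ℕ}

lemma suc_subset {η : List ℕ} : suc p.tree η ⊆ suc n.T η :=
  fun _ hm => (p.isQ0.subset_T _ hm).1

lemma suc_nonempty {η : List ℕ} (hη : η ∈ p.tree) : (suc p.tree η).Nonempty :=
  p.isQ0.no_max η hη

lemma exists_length_eq (p : Q1 n) (l : ℕ) : ∃ η ∈ p.tree, η.length = l := by
  induction l with
  | zero => exact ⟨[], p.isQ0.prefix_mem _ p.isQ0.trunk_mem _ List.nil_prefix, rfl⟩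
  | succ l ih =>
    obtain ⟨η, hη, rfl⟩ := ih
    obtain ⟨m, hm⟩ := p.isQ0.no_max η hη
    exact ⟨_, hm, by simp⟩

/-- A level from which on all norms are at least `5 * (w + 2)`, where `w` codes `F`. -/
def IsLarge (p : Q1 n) (F : Finset ℕ) (k : ℕ) : Prop :=
  ∀ η ∈ p.tree, k ≤ η.length →
    5 * ((Denumerable.eqv (Finset ℕ) F : ℝ) + 2) ≤ n.nor η (suc p.tree η)

lemma exists_isLarge (p : Q1 n) (F : Finset ℕ) : ∃ k, 1 ≤ k ∧ p.IsLarge F k := by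
  obtain ⟨k, hk, h⟩ := p.uniform (5 * (Denumerable.eqv (Finset ℕ) F + 2))
  exact ⟨k, by omega, fun η hη hl => by exact_mod_cast h η hη hl⟩

lemma IsLarge.mono {F : Finset ℕ} {k k' : ℕ} (h : p.IsLarge F k) (hk : k ≤ k') :
    p.IsLarge F k' := fun η hη hl => h η hη (hk.trans hl)

/-- Above a node of `p` the sets of active indices can be prescribed, if the norms allow it. -/
lemma exists_extension (hs : s ∈ p.tree) (hs1 : 1 ≤ s.length) {F : ℕ → Finset ℕ}
    (hF : ∀ l, s.length ≤ l → p.IsLarge (F l) l) {L : ℕ} (hL : s.length ≤ L) :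
    ∃ t ∈ p.tree, t.length = L ∧
      ∀ i l, n.ActiveAt t i l ↔ n.ActiveAt s i l ∨ s.length ≤ l ∧ l < L ∧ i ∈ F l := by
  induction L, hL using Nat.le_induction with
  | base => exact ⟨s, hs, rfl, fun i l => ⟨Or.inl, fun h => h.resolve_right (by omega)⟩⟩
  | succ L hL ih =>
    obtain ⟨t, ht, rfl, h⟩ := ih
    obtain ⟨m, hm, hr⟩ := Param.exists_rank_eq (p.isQ0.subset_T t ht).1 (hs1.trans hL)
      (suc_nonempty ht) suc_subset (hF _ hL t ht le_rfl)
    have hact : n.active t m = F t.length := by simp [Param.active, hr]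
    refine ⟨t ++ [m], hm, by simp, fun i l => ?_⟩
    rw [Param.activeAt_append_singleton, h, hact]
    constructor
    · rintro ((h | ⟨h₁, h₂, h₃⟩) | ⟨rfl, h⟩)
      · exact Or.inl h
      · exact Or.inr ⟨h₁, h₂.trans (Nat.lt_succ_self _), h₃⟩
      · exact Or.inr ⟨hL, Nat.lt_succ_self _, h⟩
    · rintro (h | ⟨h₁, h₂, h₃⟩)
      · exact Or.inl (Or.inl h)
      · rcases Nat.lt_succ_iff_lt_or_eq.1 h₂ with h | rfl
        · exact Or.inl (Or.inr ⟨h₁, h, h₃⟩)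
        · exact Or.inr ⟨rfl, h₃⟩

/-- The nodes of `S` comparable with `s` all of whose ranks above `s` are bounded by `W`. -/
def pruneTree (n : Param) (S : Set (List ℕ)) (s : List ℕ) (W : ℕ → ℕ) : Set (List ℕ) :=
  {η | η ∈ S ∧ (η <+: s ∨ s <+: η) ∧
    ∀ ν m, s <+: ν → ν ++ [m] <+: η → n.rank ν m < W ν.length}

lemma suc_pruneTree {S : Set (List ℕ)} {W : ℕ → ℕ} {η : List ℕ} (hη : η ∈ pruneTree n S s W)
    (hs : s <+: η) :
    suc (pruneTree n S s W) η = suc S η ∩ {m | n.rank η m < W η.length} := by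
  ext m
  constructor
  · rintro ⟨h₁, -, h₃⟩
    exact ⟨h₁, h₃ η m hs (List.prefix_refl _)⟩
  · rintro ⟨h₁, h₂⟩
    refine ⟨h₁, Or.inr (hs.trans (List.prefix_append _ _)), fun ν m' hν hp => ?_⟩
    rcases List.prefix_concat_iff.1 hp with h | h
    · obtain ⟨rfl, h'⟩ := List.append_inj' h rfl
      obtain rfl : m' = m := by simpa using h'
      exact h₂
    · exact hη.2.2 ν m' hν h

lemma length_res (x : ℕ → ℕ) (l : ℕ) : (res x l).length = l := by simp [res]

/-- The condition with trunk `s` below `p` obtained by bounding the ranks. -/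
lemma exists_prune (hs : s ∈ p.tree) (hs1 : 1 ≤ s.length)
    (hp : ∀ η ∈ p.tree, s.length ≤ η.length → 4 ≤ n.nor η (suc p.tree η)) {W : ℕ → ℕ}
    (hW : Tendsto W atTop atTop) (hW1 : ∀ l, s.length ≤ l → 1 ≤ W l) :
    ∃ q : Q1 n, p ≤ q ∧ q.tree = pruneTree n p.tree s W := by
  have hsmem : s ∈ pruneTree n p.tree s W := by
    refine ⟨hs, Or.inl (List.prefix_refl _), fun ν m h₁ h₂ => ?_⟩
    have := h₁.length_le
    have := h₂.length_le
    simp at this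
    omega
  have hT : ∀ η ∈ pruneTree n p.tree s W, η ∈ n.T := fun η h => (p.isQ0.subset_T η h.1).1
  have key : ∀ η ∈ pruneTree n p.tree s W, s <+: η → ∀ k : ℝ, 0 < k →
      k + 1 ≤ n.nor η (suc p.tree η) → k + 2 ≤ 5 * W η.length →
      (suc (pruneTree n p.tree s W) η).Nonempty ∧
        k ≤ n.nor η (suc (pruneTree n p.tree s W) η) := by
    intro η hη hsη k hk h₁ h₂
    rw [suc_pruneTree hη hsη]
    exact Param.nor_inter_rank_lt (hT η hη) (hs1.trans hsη.length_le) (suc_nonempty hη.1)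
      suc_subset (hW1 _ hsη.length_le) hk h₁ h₂
  have key3 : ∀ η ∈ pruneTree n p.tree s W, s <+: η →
      (suc (pruneTree n p.tree s W) η).Nonempty ∧
        3 ≤ n.nor η (suc (pruneTree n p.tree s W) η) := by
    intro η hη hsη
    have h₁ := hp η hη.1 hsη.length_le
    have h₂ : (1 : ℝ) ≤ W η.length := by exact_mod_cast hW1 _ hsη.length_le
    -- The norm 4 loses 1, and `W ≥ 1` gives `3 + 2 ≤ 5 * W`; 3 exceeds the bound `2 - 1 / μ_s`.
    exact key η hη hsη 3 (by norm_num) (by linarith) (by linarith)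
  have huni : ∀ N : ℕ, ∃ k : ℕ, s.length < k ∧ ∀ η ∈ pruneTree n p.tree s W, k ≤ η.length →
      (N : ℝ) ≤ n.nor η (suc (pruneTree n p.tree s W) η) := by
    intro N
    obtain ⟨k₁, -, hk₁⟩ := p.uniform (N + 2)
    obtain ⟨k₂, hk₂⟩ := eventually_atTop.1 (hW.eventually_ge_atTop (N + 3))
    refine ⟨s.length + 1 + k₁ + k₂, by omega, fun η hη hl => ?_⟩
    have hsη : s <+: η := hη.2.1.resolve_left fun h => by have := h.length_le; omega
    have h₁ := hk₁ η hη.1 (by omega)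
    have h₂ : ((N + 3 : ℕ) : ℝ) ≤ W η.length := by exact_mod_cast hk₂ η.length (by omega)
    push_cast at h₁ h₂
    have hN : (0 : ℝ) ≤ N := N.cast_nonneg
    -- `N + 1` is used instead of `N` so that the target norm is positive even for `N = 0`.
    exact le_trans (by linarith)
      (key η hη hsη (N + 1) (by linarith) (by linarith) (by linarith)).2
  refine ⟨⟨s, pruneTree n p.tree s W, ⟨hsmem, fun η h => ⟨hT η h, h.2.1⟩, ?_, ?_, ?_, ?_⟩, huni⟩,
    fun η hη => hη.1, rfl⟩
  · intro η hη ν hν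
    refine ⟨p.isQ0.prefix_mem η hη.1 ν hν, ?_, fun σ m h₁ h₂ => hη.2.2 σ m h₁ (h₂.trans hν)⟩
    rcases hη.2.1 with h | h
    · exact Or.inl (hν.trans h)
    · exact List.prefix_or_prefix_of_prefix hν h
  · intro η hη
    by_cases hsη : s <+: η
    · exact (key3 η hη hsη).1
    · obtain ⟨t, rfl⟩ := hη.2.1.resolve_right hsη
      cases t with
      | nil => simp at hsη
      | cons m t =>
        have hpre : η ++ [m] <+: η ++ m :: t := ⟨t, by simp⟩
        refine ⟨m, p.isQ0.prefix_mem _ hs _ hpre, Or.inl hpre, fun ν m' h₁ h₂ => ?_⟩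
        exact hsmem.2.2 ν m' h₁ (h₂.trans hpre)
  · intro x hx
    rw [tendsto_atTop]
    intro b
    obtain ⟨N, hN⟩ := exists_nat_ge b
    obtain ⟨k, -, hk⟩ := huni N
    filter_upwards [eventually_ge_atTop k] with l hl
    exact hN.trans (hk _ (hx l) (by rwa [length_res]))
  · intro η hη hsη
    have h₁ : 0 ≤ 1 / n.mu s := one_div_nonneg.2 (n.mu_nonneg s (hT s hsmem))
    linarith [(key3 η hη hsη).2]

lemma four_le_nor_of_isLarge {F : Finset ℕ} {k : ℕ} (h : p.IsLarge F k) :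
    ∀ η ∈ p.tree, k ≤ η.length → 4 ≤ n.nor η (suc p.tree η) := by
  intro η hη hl
  have h₁ := h η hη hl
  have h₂ : (0 : ℝ) ≤ (Denumerable.eqv (Finset ℕ) F : ℝ) := Nat.cast_nonneg _
  linarith

/-- Every condition has a node along which the active indices are exactly those below some `M`. -/
lemma exists_activeAt_iff_lt (p : Q1 n) (M₀ : ℕ) : ∃ s ∈ p.tree, ∃ M, M₀ ≤ M ∧
    1 ≤ s.length ∧ p.IsLarge ∅ s.length ∧ ∀ i, (∃ l, n.ActiveAt s i l) ↔ i < M := by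
  obtain ⟨k, hk1, hk⟩ := p.exists_isLarge ∅
  obtain ⟨s, hs, rfl⟩ := p.exists_length_eq k
  obtain ⟨M, hM⟩ := n.exists_bound_active s
  obtain ⟨k', -, hk'⟩ := p.exists_isLarge (Finset.range (max M M₀))
  -- Code nothing new until the norms suffice to code the whole interval, which also covers all
  -- indices already active at `s`.
  obtain ⟨t, ht, hl, h⟩ := exists_extension hs hk1 (L := s.length + k' + 1)
    (F := fun l => if l = s.length + k' then Finset.range (max M M₀) else ∅) (by
      intro l hl
      split_ifs with h
      · exact hk'.mono (by omega)
      · exact hk.mono hl) (by omega)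
  refine ⟨t, ht, max M M₀, le_max_right _ _, by omega, hk.mono (by omega),
    fun i => ⟨?_, fun hi => ?_⟩⟩
  · rintro ⟨l, hil⟩
    rcases (h i l).1 hil with h | ⟨-, -, h⟩
    · exact lt_max_of_lt_left (hM i l h)
    · split_ifs at h
      · exact Finset.mem_range.1 h
      · simp at h
  · exact ⟨s.length + k', (h i _).2 (Or.inr ⟨by omega, by omega, by simpa using hi⟩)⟩

/-- A condition all of whose nodes are comparable with `s` decides what `s` decides. -/
lemma firstAt_of_comparable {i l : ℕ} (h : n.FirstAt s i l)
    (hq : ∀ η ∈ q.tree, η <+: s ∨ s <+: η) :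
    ∀ η ∈ q.tree, l < η.length → n.FirstAt η i l :=
  fun η hη hl => h.of_comparable (hq η hη).symm hl

end Q1

/-! ### The generic real and its genericity -/

/-- The name of the real whose value at `i` is the first level of the generic branch at which `i`
is active. -/
def firstActive (n : Param) : Forcing.RealName (Q1 n) where
  rel i l := {c | ∀ η ∈ c.tree, l < η.length → n.FirstAt η i l}
  total i p := by
    obtain ⟨s, hs, M, hM, hs1, hlarge, h⟩ := p.exists_activeAt_iff_lt (i + 1)
    obtain ⟨l, hl⟩ := (h i).2 (by omega)
    obtain ⟨l, hl⟩ := hl.exists_firstAt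
    -- Only the comparability of all nodes with `s` matters here; `id` is a convenient rank bound.
    obtain ⟨q, hpq, hq⟩ := Q1.exists_prune hs hs1 (Q1.four_le_nor_of_isLarge hlarge)
      (W := id) Filter.tendsto_id (fun l hl => hs1.trans hl)
    refine ⟨q, hpq, l, q, Q1.firstAt_of_comparable hl fun η hη => ?_, le_rfl⟩
    rw [hq] at hη
    exact hη.2.1
  functional i l l' c c' r hc hc' hcr hcr' := by
    obtain ⟨η, hη, hl⟩ := r.exists_length_eq (l + l' + 1)
    exact (hc η (hcr hη) (by omega)).unique (hc' η (hcr' hη) (by omega))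

lemma firstActive_forcesGe {n : Param} {p : Q1 n} {i k : ℕ}
    (h : ∀ η ∈ p.tree, ∀ l, n.ActiveAt η i l → k ≤ l) : (firstActive n).ForcesGe p i k := by
  intro q hq
  obtain ⟨r, hr, m, c, hc, hcr⟩ := (firstActive n).total i q
  refine ⟨r, hr, m, ?_, (Forcing.RealName.forcesEq_of_mem_rel hc).mono hcr⟩
  obtain ⟨η, hη, hl⟩ := r.exists_length_eq (m + 1)
  exact h η (hq (hr hη)) m (hc η (hcr hη) (by omega)).1

/-- Let `W l` be the largest `b ≤ l` for which the property holds at `l`. As finitely many codes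
involve finitely many indices, each `b` is eventually admissible. -/
lemma exists_slow_bound (E : ℕ → Finset ℕ) (g : ℕ → ℕ) : ∃ W : ℕ → ℕ,
    Filter.Tendsto W Filter.atTop Filter.atTop ∧ ∀ l w, w < W l → ∀ i ∈ E w, g i ≤ l := by
  classical
  let P : ℕ → ℕ → Prop := fun l b => ∀ w < b, ∀ i ∈ E w, g i ≤ l
  refine ⟨fun l => Nat.findGreatest (P l) l, Filter.tendsto_atTop.2 fun N => ?_, fun l w hw => ?_⟩
  · filter_upwards [Filter.eventually_ge_atTop
      (N + ∑ w ∈ Finset.range N, ∑ i ∈ E w, g i)] with l hl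
    refine Nat.le_findGreatest (by omega) fun w hw i hi => ?_
    have h₁ : g i ≤ ∑ i ∈ E w, g i := Finset.single_le_sum (fun _ _ => Nat.zero_le _) hi
    have h₂ : ∑ i ∈ E w, g i ≤ ∑ w ∈ Finset.range N, ∑ i ∈ E w, g i :=
      Finset.single_le_sum (f := fun w => ∑ i ∈ E w, g i) (fun _ _ => Nat.zero_le _)
        (Finset.mem_range.2 hw)
    omega
  · exact Nat.findGreatest_spec (P := P l) (Nat.zero_le l)
      (fun w hw => absurd hw (Nat.not_lt_zero w)) w hw

lemma firstActive_isHechler (n : Param) : (firstActive n).IsHechler := by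
  classical
  refine .of_generic fun D hD p => ?_
  obtain ⟨s, hs, M, -, hs1, hlarge, hact⟩ := p.exists_activeAt_iff_lt 0
  have hfirst : ∀ i, ∃ l, i < M → n.FirstAt s i l := fun i => by
    by_cases hi : i < M
    · obtain ⟨l, hl⟩ := (hact i).2 hi
      obtain ⟨l, hl⟩ := hl.exists_firstAt
      exact ⟨l, fun _ => hl⟩
    · exact ⟨0, fun h => absurd h hi⟩
  choose t ht using hfirst
  choose k _ hk using fun F => p.exists_isLarge F
  -- The sum bounds `k F` for every `F` with maximum at most `i`, so from level `f i` on any such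
  -- `F` can be coded.
  let f : ℕ → ℕ := fun i => s.length + ∑ F ∈ (Finset.range (i + 1)).powerset, k F
  obtain ⟨e, heD, hde⟩ := hD ⟨(List.range M).map t, fun i => if i < M then t i else f i,
    fun i hi => by
      have : i < M := by simpa using hi
      simp [this]⟩
  have hMA : M ≤ e.stem.length := by simpa using hde.1.length_le
  have heM : ∀ i, i < M → e.fn i = t i := fun i hi => by
    have h := hde.1.getElem (i := i) (by simpa using hi)
    rw [e.stem_eq i (hi.trans_le hMA), ← h]
    simp
  have hef : ∀ i, M ≤ i → f i ≤ e.fn i := fun i hi => by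
    have := hde.2 i
    simpa [not_lt.2 hi] using this
  -- Several new indices may share the value `l`, so they must be activated together by one code.
  let F : ℕ → Finset ℕ := fun l => (Finset.Ico M e.stem.length).filter fun i => e.fn i = l
  have hF : ∀ l, s.length ≤ l → p.IsLarge (F l) l := by
    intro l hl
    rcases (F l).eq_empty_or_nonempty with h | h
    · rw [h]
      exact hlarge.mono hl
    · have hmax := (F l).max'_mem h
      simp only [F, Finset.mem_filter, Finset.mem_Ico] at hmax
      have h₁ := hef _ hmax.1.1
      refine (hk (F l)).mono (le_trans ?_ (h₁.trans_eq hmax.2))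
      refine le_trans (Finset.single_le_sum (f := k) (fun _ _ => Nat.zero_le _) ?_)
        (Nat.le_add_left _ _)
      exact Finset.mem_powerset.2 fun i hi =>
        Finset.mem_range.2 (Nat.lt_succ_of_le ((F l).le_max' i hi))
  -- A rank below `W l` codes only indices `i` with `e.fn i ≤ l`.
  obtain ⟨W, hW, hWe⟩ := exists_slow_bound (Denumerable.eqv (Finset ℕ)).symm e.fn
  obtain ⟨L, hL⟩ := Filter.eventually_atTop.1 (hW.eventually_ge_atTop 1)
  -- The length passes every level `e.fn i` to be realized on the stem, and `L`, after which `W ≥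
  -- 1`.
  obtain ⟨u, hu, hul, hua⟩ := Q1.exists_extension hs hs1 hF
    (L := s.length + L + ∑ i ∈ Finset.range e.stem.length, (e.fn i + 1)) (by omega)
  obtain ⟨q, hpq, hq⟩ := Q1.exists_prune hu (by omega)
    (Q1.four_le_nor_of_isLarge (hlarge.mono (by omega))) hW (fun l hl => hL l (by omega))
  have hcomp : ∀ η ∈ q.tree, η <+: u ∨ u <+: η := fun η hη => by
    rw [hq] at hη
    exact hη.2.1
  have hufirst : ∀ i, i < e.stem.length → n.FirstAt u i (e.fn i) := by
    intro i hi
    have hlt : e.fn i < u.length := by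
      have : e.fn i + 1 ≤ ∑ i ∈ Finset.range e.stem.length, (e.fn i + 1) :=
        Finset.single_le_sum (f := fun i => e.fn i + 1) (fun _ _ => Nat.zero_le _)
          (Finset.mem_range.2 hi)
      omega
    by_cases hiM : i < M
    · have h := ht i hiM
      rw [heM i hiM] at hlt ⊢
      have hno : ∀ l, i ∉ F l := fun l hl => by
        simp only [F, Finset.mem_filter, Finset.mem_Ico] at hl
        omega
      exact ⟨(hua _ _).2 (Or.inl h.1), fun l hl h' =>
        h.2 l hl (((hua _ _).1 h').resolve_right fun h'' => hno l h''.2.2)⟩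
    · have hno : ∀ l, ¬ n.ActiveAt s i l := fun l hl => hiM ((hact i).1 ⟨l, hl⟩)
      have hle : s.length ≤ e.fn i := (Nat.le_add_right _ _).trans (hef i (by omega))
      refine ⟨(hua _ _).2 (Or.inr ⟨hle, by omega, ?_⟩), fun l hl h' => ?_⟩
      · exact Finset.mem_filter.2 ⟨Finset.mem_Ico.2 ⟨not_lt.1 hiM, hi⟩, rfl⟩
      · have h := (((hua _ _).1 h').resolve_left (hno l)).2.2
        simp only [F, Finset.mem_filter, Finset.mem_Ico] at h
        omega
  have heq : ∀ i, i < e.stem.length → (firstActive n).ForcesEq q i (e.fn i) := fun i hi =>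
    Forcing.RealName.forcesEq_of_mem_rel (Q1.firstAt_of_comparable (hufirst i hi) hcomp)
  refine ⟨q, hpq, e, heD, fun i hi => ?_, fun i => ?_⟩
  · rw [← e.stem_eq i hi]
    exact heq i hi
  · by_cases hi : i < e.stem.length
    · exact (heq i hi).forcesGe
    · refine firstActive_forcesGe fun η hη l hl => ?_
      -- Below the length of `u`, only indices of the stem are active; from there on the rank bound
      -- gives `e.fn i ≤ l`.
      rcases lt_or_ge l u.length with hlu | hlu
      · exfalso
        rcases (hua _ _).1 (hl.of_comparable (hcomp η hη) hlu) with h | ⟨-, -, h⟩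
        · have := (hact i).1 ⟨l, h⟩
          omega
        · simp only [F, Finset.mem_filter, Finset.mem_Ico] at h
          omega
      · obtain ⟨ν, m, rfl, hp, hi'⟩ := hl
        have hνη : ν <+: η := (List.prefix_append _ _).trans hp
        have huη : u <+: η := (hcomp η hη).resolve_left fun h => by
          have h₁ := h.length_le
          have h₂ := hp.length_le
          simp at h₂
          omega
        rw [hq] at hη
        exact hWe _ _ (hη.2.2 ν m (List.prefix_of_prefix_length_le huη hνη hlu) hp) i hi'

end TreeCreature

theorem claim7 (n : TreeCreature.Param) :
    (∃ τ : Forcing.RealName (TreeCreature.Q1 n), τ.IsDominating) ∧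
      (∃ ρ : Forcing.RealName (TreeCreature.Q1 n), ρ.IsHechler) :=
  ⟨⟨_, (TreeCreature.firstActive_isHechler n).isDominating⟩,
    ⟨_, TreeCreature.firstActive_isHechler n⟩⟩
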